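/- Let $X_1,X_2,\dots$ be i.i.d. real random variables with law $P_X$ and $\mathsf E[X^2]=\sigma^2$, let $\sigma^2>D_1>D_2>0$ and $R_1,R_2>0$, and write $d(x^n,y^n)=\frac1n\sum_{i=1}^n(x_i-y_i)^2$. Put $$\lambda=\min\Big\{\frac{D_2e^{2R_2}}{D_1},1\Big\},\qquad P_Y=\sigma^2-\lambda D_1,\qquad P_Z=\lambda D_1-D_2 .$$ Given $n,M_1,M_2\ge 1$, draw, independently of $X^n=(X_1,\dots,X_n)$, codewords $Y^n(1),\dots,Y^n(M_1)$ independently from $\mathcal N(0,P_Y I_n)$ and, given these, codewords $Z^n(i,j)$, $i\in[M_1]$, $j\in[M_2]$, independently with $Z^n(i,j)\sim\mathcal N(Y^n(i),P_Z I_n)$. Let $f_1=\arg\min_{i}d(X^n,Y^n(i))$, $\hat X_1^n=Y^n(f_1)$, $f_2=\arg\min_j d(X^n,Z^n(f_1,j))$, $\hat X_2^n=Z^n(f_1,f_2)$ (ties are broken by the smallest index), and let the ensemble joint excess-distortion probability be $$\mathrm P^n(D_1,D_2|M_1,M_2)=\Pr\{d(X^n,\hat X_1^n)>D_1\ \text{or}\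 d(X^n,\hat X_2^n)>D_2\}.$$ A number $E\ge0$ is an achievable exponent if there are sequences of integers $M_1=M_1(n)\ge1$ and $M_2=M_2(n)\ge1$ with $$\limsup_{n\to\infty}\tfrac1n\log M_1\le R_1,\qquad \limsup_{n\to\infty}\tfrac1n\log (M_1M_2)\le R_1+R_2,\qquad \liminf_{n\to\infty}-\tfrac1n\log \mathrm P^n(D_1,D_2|M_1,M_2)\ge E;$$ $E^*(D_1,D_2|R_1,R_2)\in[0,\infty]$ denotes the supremum of the achievable exponents. For $w\ge0$ and $P,D>0$ let $$s^*(w,P,D)=\max\Big\{0,\frac{P-2D+\sqrt{P^2+4wD}}{4D}\Big\},\qquad R_{\rm iid}(w,P,D)=\frac12\log(1+2s)+\frac{sw}{(1+2s)P}-\frac{sD}{P}\ \text{ with } s=s^*(w,P,D),$$ and let $\Lambda^*_{X^2}(t)=\sup_{\theta\ge0}\{\theta t-\log\mathsf E[e^{\theta X^2}]\}\in[0,\infty]$, where $\log\infty=\infty$. **Theorem.** If $\alpha^*\ge0$ is the solution $\alpha$ of $R_1=R_{\rm iid}(\alpha,P_Y,\lambda D_1)$, then $$E^*(D_1,D_2|R_1,R_2)\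 \ge\ \Lambda^*_{X^2}(\alpha^*).$$ -/

import Mathlib

open MeasureTheory ProbabilityTheory Filter

namespace SuccRef

/-- The quadratic distortion `d(xⁿ, yⁿ) = (1/n) ∑ᵢ (xᵢ - yᵢ)²`. -/
noncomputable def dist2 {n : ℕ} (x y : Fin n → ℝ) : ℝ :=
  (1 / (n : ℝ)) * ∑ i, (x i - y i) ^ 2

theorem exists_minimizer {n : ℕ} {M : ℕ+} (x : Fin n → ℝ) (c : Fin M → Fin n → ℝ) :
    (Finset.univ.filter fun i : Fin M => ∀ k, dist2 x (c i) ≤ dist2 x (c k)).Nonempty := by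
  have : Nonempty (Fin M) := Fin.pos_iff_nonempty.mp M.pos
  obtain ⟨i, -, hi⟩ := Finset.exists_min_image Finset.univ (fun i => dist2 x (c i))
    Finset.univ_nonempty
  exact ⟨i, Finset.mem_filter.2 ⟨Finset.mem_univ _, fun k => hi k (Finset.mem_univ _)⟩⟩

/-- Minimum Euclidean distance encoding: `argmin_i d(x, c i)`. Ties, which have probability zero
for Gaussian codewords, are resolved in favour of the smallest index. -/
noncomputable def nearest {n : ℕ} {M : ℕ+} (x : Fin n → ℝ) (c : Fin M → Fin n → ℝ) : Fin M :=
  (Finset.univ.filter fun i : Fin M => ∀ k, dist2 x (c i) ≤ dist2 x (c k)).min'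
    (exists_minimizer x c)

/-- The first-layer codebook `Y(1), …, Y(M₁)`. -/
abbrev Codebook1 (n : ℕ) (M₁ : ℕ+) : Type := Fin M₁ → Fin n → ℝ

/-- The second-layer codebooks `Z(i, 1), …, Z(i, M₂)`, one for each `i ∈ [M₁]`. -/
abbrev Codebook2 (n : ℕ) (M₁ M₂ : ℕ+) : Type := Fin M₁ → Fin M₂ → Fin n → ℝ

/-- The encoder `f₁`. -/
noncomputable def enc1 {n : ℕ} {M₁ : ℕ+} (Y : Codebook1 n M₁) (x : Fin n → ℝ) : Fin M₁ :=
  nearest x Y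

/-- The encoder `f₂`. -/
noncomputable def enc2 {n : ℕ} {M₁ M₂ : ℕ+} (Y : Codebook1 n M₁) (Z : Codebook2 n M₁ M₂)
    (x : Fin n → ℝ) : Fin M₂ :=
  nearest x (Z (enc1 Y x))

/-- The reproduction `X̂₁ = φ₁(f₁(x))`. -/
noncomputable def rep1 {n : ℕ} {M₁ : ℕ+} (Y : Codebook1 n M₁) (x : Fin n → ℝ) : Fin n → ℝ :=
  Y (enc1 Y x)

/-- The reproduction `X̂₂ = φ₂(f₁(x), f₂(x))`. -/
noncomputable def rep2 {n : ℕ} {M₁ M₂ : ℕ+} (Y : Codebook1 n M₁) (Z : Codebook2 n M₁ M₂)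
    (x : Fin n → ℝ) : Fin n → ℝ :=
  Z (enc1 Y x) (enc2 Y Z x)

/-- The product Gaussian law `f_iid(· | cⁿ, P)` with mean vector `c` and variance `P > 0` in each
coordinate. -/
noncomputable def fiid {n : ℕ} (c : Fin n → ℝ) (P : ℝ) : Measure (Fin n → ℝ) :=
  Measure.pi fun i => gaussianReal (c i) P.toNNReal

instance {n : ℕ} (c : Fin n → ℝ) (P : ℝ) : IsProbabilityMeasure (fiid c P) := by
  unfold fiid; infer_instance

/-- The law of the first-layer random codebook: `M₁` independent codewords with law
`f_iid(· | 0, P_Y)`. -/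
noncomputable def codebook1Law (n : ℕ) (M₁ : ℕ+) (PY : ℝ) : Measure (Codebook1 n M₁) :=
  Measure.pi fun _ => fiid 0 PY

/-- The conditional law, given the first-layer codebook `Y`, of the second-layer random codebooks:
the codewords `Z(i, j)` are independent, with law `f_iid(· | Y(i), P_Z)`. -/
noncomputable def codebook2CondLaw (n : ℕ) (M₁ M₂ : ℕ+) (PZ : ℝ) (Y : Codebook1 n M₁) :
    Measure (Codebook2 n M₁ M₂) :=
  Measure.pi fun i => Measure.pi fun _ => fiid (Y i) PZ

instance (n : ℕ) (M₁ M₂ : ℕ+) (PZ : ℝ) (Y : Codebook1 n M₁) :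
    IsProbabilityMeasure (codebook2CondLaw n M₁ M₂ PZ Y) := by
  unfold codebook2CondLaw; infer_instance

theorem fiid_eq_map {n : ℕ} (c : Fin n → ℝ) (P : ℝ) :
    fiid c P = (fiid (0 : Fin n → ℝ) P).map (fun w k => w k + c k) := by
  unfold fiid
  rw [Measure.pi_map_pi (f := fun k w => w + c k) (fun k => by fun_prop)]
  congr 1
  funext k
  rw [gaussianReal_map_add_const]
  simp

theorem codebook2CondLaw_eq_map (n : ℕ) (M₁ M₂ : ℕ+) (PZ : ℝ) (Y : Codebook1 n M₁) :
    codebook2CondLaw n M₁ M₂ PZ Y =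
      (codebook2CondLaw n M₁ M₂ PZ 0).map (fun W i j k => W i j k + Y i k) := by
  unfold codebook2CondLaw
  have h1 : ∀ i : Fin M₁, (Measure.pi fun _ : Fin M₂ => fiid (Y i) PZ) =
      (Measure.pi fun _ : Fin M₂ => fiid ((0 : Codebook1 n M₁) i) PZ).map
        (fun W j k => W j k + Y i k) := by
    intro i
    rw [Measure.pi_map_pi (f := fun (_ : Fin M₂) (w : Fin n → ℝ) k => w k + Y i k)
      (fun j => (by fun_prop : Measurable fun (w : Fin n → ℝ) k => w k + Y i k).aemeasurable)]
    congr 1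
    funext j
    exact fiid_eq_map _ _
  have : ∀ i : Fin M₁, SigmaFinite
      ((Measure.pi fun _ : Fin M₂ => fiid ((0 : Codebook1 n M₁) i) PZ).map
        (fun W j k => W j k + Y i k)) := fun i => by rw [← h1 i]; infer_instance
  rw [Measure.pi_map_pi (f := fun (i : Fin M₁) (W : Fin M₂ → Fin n → ℝ) j k => W j k + Y i k)
    (fun i => (by fun_prop : Measurable fun (W : Fin M₂ → Fin n → ℝ) j k =>
      W j k + Y i k).aemeasurable)]
  congr 1
  funext i
  exact h1 i

theorem measurable_codebook2CondLaw (n : ℕ) (M₁ M₂ : ℕ+) (PZ : ℝ) :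
    Measurable (codebook2CondLaw n M₁ M₂ PZ) := by
  refine Measure.measurable_of_measurable_coe _ fun s hs => ?_
  have hm : Measurable (fun p : Codebook1 n M₁ × Codebook2 n M₁ M₂ =>
      (fun i j k => p.2 i j k + p.1 i k : Codebook2 n M₁ M₂)) := by fun_prop
  have h := measurable_measure_prodMk_left (ν := codebook2CondLaw n M₁ M₂ PZ 0) (hm hs)
  have heq : (fun Y => codebook2CondLaw n M₁ M₂ PZ Y s) = fun Y =>
      codebook2CondLaw n M₁ M₂ PZ 0 (Prod.mk Y ⁻¹'
        ((fun p : Codebook1 n M₁ × Codebook2 n M₁ M₂ =>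
          (fun i j k => p.2 i j k + p.1 i k : Codebook2 n M₁ M₂)) ⁻¹' s)) := by
    funext Y
    rw [codebook2CondLaw_eq_map n M₁ M₂ PZ Y, Measure.map_apply (by fun_prop) hs]
    rfl
  rw [heq]
  exact h

/-- `codebook2CondLaw` as a Markov kernel. -/
noncomputable def codebook2Kernel (n : ℕ) (M₁ M₂ : ℕ+) (PZ : ℝ) :
    Kernel (Codebook1 n M₁) (Codebook2 n M₁ M₂) where
  toFun := codebook2CondLaw n M₁ M₂ PZ
  measurable' := measurable_codebook2CondLaw n M₁ M₂ PZ

instance (n : ℕ) (M₁ M₂ : ℕ+) (PZ : ℝ) : IsMarkovKernel (codebook2Kernel n M₁ M₂ PZ) :=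
  ⟨fun Y => inferInstanceAs (IsProbabilityMeasure (codebook2CondLaw n M₁ M₂ PZ Y))⟩

/-- The joint law of the source sequence `Xⁿ` (i.i.d. with law `PX`) and of the random codebooks
`(Y, Z)`, the latter being independent of `Xⁿ`. -/
noncomputable def jointLaw (PX : Measure ℝ) (PY PZ : ℝ) (n : ℕ) (M₁ M₂ : ℕ+) :
    Measure ((Fin n → ℝ) × (Codebook1 n M₁ × Codebook2 n M₁ M₂)) :=
  (Measure.pi fun _ => PX).prod (codebook1Law n M₁ PY ⊗ₘ codebook2Kernel n M₁ M₂ PZ)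

/-- The ensemble joint excess-distortion probability
`Pr{d(Xⁿ, X̂₁ⁿ) > D₁ or d(Xⁿ, X̂₂ⁿ) > D₂}`. -/
noncomputable def jep (PX : Measure ℝ) (PY PZ D₁ D₂ : ℝ) (n : ℕ) (M₁ M₂ : ℕ+) : ENNReal :=
  jointLaw PX PY PZ n M₁ M₂
    {p | D₁ < dist2 p.1 (rep1 p.2.1 p.1) ∨ D₂ < dist2 p.1 (rep2 p.2.1 p.2.2 p.1)}

/-- `E ≥ 0` is an achievable exponent under the joint excess-distortion probability at rates
`(R₁, R₂)`, for i.i.d. Gaussian codebooks of powers `PY` and `PZ`. -/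
def AchievableExponent (PX : Measure ℝ) (PY PZ D₁ D₂ R₁ R₂ E : ℝ) : Prop :=
  0 ≤ E ∧ ∃ M₁ M₂ : ℕ → ℕ+,
    limsup (fun n : ℕ => ((1 / (n : ℝ) * Real.log (M₁ n : ℝ) : ℝ) : EReal)) atTop
        ≤ (R₁ : EReal) ∧
    limsup (fun n : ℕ => ((1 / (n : ℝ) * Real.log ((M₁ n : ℝ) * (M₂ n : ℝ)) : ℝ) : EReal)) atTop
        ≤ ((R₁ + R₂ : ℝ) : EReal) ∧
    (E : EReal) ≤ liminf (fun n : ℕ => ((1 / (n : ℝ) : ℝ) : EReal) *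
        (-ENNReal.log (jep PX PY PZ D₁ D₂ n (M₁ n) (M₂ n)))) atTop

/-- The optimal exponent `E*(D₁, D₂ | R₁, R₂)`: the supremum, possibly `+∞`, of all achievable
exponents. -/
noncomputable def optExponent (PX : Measure ℝ) (PY PZ D₁ D₂ R₁ R₂ : ℝ) : EReal :=
  ⨆ (E : ℝ) (_ : AchievableExponent PX PY PZ D₁ D₂ R₁ R₂ E), (E : EReal)

/-- `R_iid(s, w, P, D)`. -/
noncomputable def RiidAt (s w P D : ℝ) : ℝ :=
  1 / 2 * Real.log (1 + 2 * s) + s * w / ((1 + 2 * s) * P) - s * D / P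

/-- `s*(w, P, D)`. -/
noncomputable def sStar (w P D : ℝ) : ℝ :=
  max 0 ((P - 2 * D + Real.sqrt (P ^ 2 + 4 * w * D)) / (4 * D))

/-- `R_iid(w, P, D) = R_iid(s*(w, P, D), w, P, D)`. -/
noncomputable def Riid (w P D : ℝ) : ℝ := RiidAt (sStar w P D) w P D

/-- The cumulant generating function `Λ_{X²}(θ) = log E[exp(θ X²)]`, with value `+∞` where the
expectation is infinite. -/
noncomputable def cgfSq (PX : Measure ℝ) (θ : ℝ) : EReal :=
  ENNReal.log (∫⁻ x, ENNReal.ofReal (Real.exp (θ * x ^ 2)) ∂PX)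

/-- The Fenchel-Legendre transform `Λ*_{X²}(t) = sup_{θ ≥ 0} (θ t - Λ_{X²}(θ))`. -/
noncomputable def legendreSq (PX : Measure ℝ) (t : ℝ) : EReal :=
  ⨆ (θ : ℝ) (_ : 0 ≤ θ), (((θ * t : ℝ) : EReal) - cgfSq PX θ)

end SuccRef

namespace SuccRef

/-! Put `Δ = λ D₁ = min (D₂ e^{2R₂}) D₁`. The codebooks can be sized so that, for every source word
with `∑ xᵢ² ≤ nα`, encoding fails with superexponentially small probability. Only atypical words
then matter, and Chernoff's bound gives them exponent `θα - log E[e^{θX²}]` for each `θ ≥ 0`.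

The core is a lower bound `e^{-n(Riid + ε)}`, uniform over typical words, for the probability that
one Gaussian codeword is close (`eventually_exp_neg_Riid_le_fiid_real`). It replaces a change of
measure by comparing the explicit Laplace transform of the squared distance at `s` and `s ± t`.
About `e^{nR}` codewords, with a factor `n²` to spare, then make a miss as rare as `e^{-n²}`
(`exists_codebook_size`).

The first layer aims at `Δ`, which costs `R₁` by the choice of `α`. Relative to a codeword within
`Δ`, the residual is a word of power at most `Δ`, and refining it to `D₂` with power `Δ - D₂` costs
`½ log (Δ / D₂) ≤ R₂`. A union bound over all `M₁` first-layer indices (`jep_le`) is harmless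
against `e^{-n²}`. -/

/-! ### Laplace transform of the squared distance to a Gaussian codeword -/

theorem integral_exp_neg_sq_gaussianReal (s x P : ℝ) (hs : 0 ≤ s) (hP : 0 < P) :
    ∫ y, Real.exp (-s * (x - y) ^ 2) ∂gaussianReal 0 P.toNNReal =
      Real.exp (-(1 / 2) * Real.log (1 + 2 * s * P) - s * x ^ 2 / (1 + 2 * s * P)) := by
  have hq : 0 < 1 + 2 * s * P := by positivity
  have hPne : P.toNNReal ≠ 0 := by simpa using hP
  have hv : 0 < P / (1 + 2 * s * P) := by positivity
  have hvne : (P / (1 + 2 * s * P)).toNNReal ≠ 0 := by simpa using hv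
  rw [integral_gaussianReal_eq_integral_smul hPne]
  -- Completing the square: the tilted density is a multiple of another Gaussian density.
  have key : ∀ y, gaussianPDFReal 0 P.toNNReal y • Real.exp (-s * (x - y) ^ 2) =
      Real.exp (-(1 / 2) * Real.log (1 + 2 * s * P) - s * x ^ 2 / (1 + 2 * s * P)) *
        gaussianPDFReal (2 * s * P * x / (1 + 2 * s * P)) (P / (1 + 2 * s * P)).toNNReal y := by
    intro y
    simp only [gaussianPDFReal, Real.coe_toNNReal _ hP.le, Real.coe_toNNReal _ hv.le, smul_eq_mul]
    have h1 : Real.sqrt (2 * Real.pi * (P / (1 + 2 * s * P))) =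
        Real.sqrt (2 * Real.pi * P) * Real.exp (-(1 / 2) * Real.log (1 + 2 * s * P)) := by
      rw [show 2 * Real.pi * (P / (1 + 2 * s * P)) = (2 * Real.pi * P) * (1 + 2 * s * P)⁻¹ by
        field_simp, Real.sqrt_mul (by positivity), Real.sqrt_eq_rpow (1 + 2 * s * P)⁻¹,
        Real.rpow_def_of_pos (by positivity), Real.log_inv]
      congr 2
      ring
    rw [h1, sub_eq_add_neg (-(1 / 2) * _), Real.exp_add, mul_inv]
    have h2 : -(y - 0) ^ 2 / (2 * P) + -s * (x - y) ^ 2 =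
        -(s * x ^ 2 / (1 + 2 * s * P)) +
          -(y - 2 * s * P * x / (1 + 2 * s * P)) ^ 2 / (2 * (P / (1 + 2 * s * P))) := by
      field_simp
      ring
    rw [mul_assoc, ← Real.exp_add, h2, Real.exp_add]
    field_simp
  simp_rw [key]
  rw [integral_const_mul, integral_gaussianPDFReal_eq_one _ hvne, mul_one]

theorem integral_exp_neg_sum_sq_fiid {n : ℕ} (s P : ℝ) (x : Fin n → ℝ) (hs : 0 ≤ s)
    (hP : 0 < P) :
    ∫ y, Real.exp (-s * ∑ i, (x i - y i) ^ 2) ∂fiid 0 P =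
      Real.exp (-(n / 2) * Real.log (1 + 2 * s * P) - s * (∑ i, x i ^ 2) / (1 + 2 * s * P)) := by
  simp_rw [Finset.mul_sum, Real.exp_sum, fiid]
  rw [integral_fintype_prod_eq_prod (f := fun i y => Real.exp (-s * (x i - y) ^ 2))]
  simp only [Pi.zero_apply, integral_exp_neg_sq_gaussianReal _ _ _ hs hP]
  rw [← Real.exp_sum, Finset.sum_sub_distrib, Finset.sum_const, Finset.sum_div]
  congr 2
  simp
  ring

theorem integrable_exp_neg_sum_sq_fiid {n : ℕ} (s P : ℝ) (x : Fin n → ℝ) (hs : 0 ≤ s) :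
    Integrable (fun y : Fin n → ℝ => Real.exp (-s * ∑ i, (x i - y i) ^ 2)) (fiid 0 P) := by
  refine Integrable.of_bound
    (by fun_prop : Measurable _).aestronglyMeasurable 1 (Eventually.of_forall fun y => ?_)
  rw [Real.norm_eq_abs, abs_of_pos (Real.exp_pos _), Real.exp_le_one_iff]
  have : 0 ≤ ∑ i, (x i - y i) ^ 2 := Finset.sum_nonneg fun i _ => sq_nonneg _
  nlinarith

/-- Since `z / (1 + z) = 1 - 1 / (1 + z) ≤ log (1 + z)`, this one bound controls both the
logarithmic and the rational term of the log-Laplace transform. -/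
theorem sub_two_mul_sq_le_div {z : ℝ} (hz : |z| ≤ 1 / 2) : z - 2 * z ^ 2 ≤ z / (1 + z) := by
  obtain ⟨h1, h2⟩ := abs_le.1 hz
  rw [le_div_iff₀ (by linarith)]
  nlinarith [mul_nonneg (sq_nonneg z) (by linarith : 0 ≤ 1 + 2 * z)]

/-- The logarithm of the Laplace transform of the squared distance between `x`, with
`∑ i, x i ^ 2 = W`, and a Gaussian codeword is quadratically close to its tangent. -/
theorem logLaplace_increment_le {N W P s z : ℝ} (hN : 0 ≤ N) (hW : 0 ≤ W) (hP : 0 < P)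
    (hs : 0 ≤ s) (hz : |z| ≤ 1 / 2) {q : ℝ} (hq : q = 1 + 2 * s * P) :
    -(N / 2) * Real.log (1 + 2 * (s + q * z / (2 * P)) * P) -
        (s + q * z / (2 * P)) * W / (1 + 2 * (s + q * z / (2 * P)) * P) ≤
      -(N / 2) * Real.log q - s * W / q - q * z / (2 * P) * (W / q ^ 2 + N * P / q) +
        z ^ 2 * (N + W / (P * q)) := by
  have hq0 : 0 < q := by rw [hq]; positivity
  have hz1 : 0 < 1 + z := by linarith [(abs_le.1 hz).1]
  -- The increment of `s` is parametrised by the relative change `z` of `q`.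
  have e1 : 1 + 2 * (s + q * z / (2 * P)) * P = q * (1 + z) := by
    field_simp
    rw [hq]
    ring
  have hlog : z - 2 * z ^ 2 ≤ Real.log (1 + z) := by
    refine (sub_two_mul_sq_le_div hz).trans ?_
    refine le_trans (le_of_eq ?_) (Real.one_sub_inv_le_log_of_pos hz1)
    field_simp
    ring
  have e2 : (s + q * z / (2 * P)) * W / (q * (1 + z)) =
      s * W / q + W / (2 * P * q) * (z / (1 + z)) := by
    have : s = (q - 1) / (2 * P) := by rw [hq]; field_simp; ring
    rw [this]
    field_simp
    ring
  rw [e1, e2, Real.log_mul hq0.ne' hz1.ne']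
  have h1 : W / (2 * P * q) * (z - 2 * z ^ 2) ≤ W / (2 * P * q) * (z / (1 + z)) :=
    mul_le_mul_of_nonneg_left (sub_two_mul_sq_le_div hz) (by positivity)
  have h2 : N / 2 * (z - 2 * z ^ 2) ≤ N / 2 * Real.log (1 + z) :=
    mul_le_mul_of_nonneg_left hlog (by positivity)
  have e3 : q * z / (2 * P) * (W / q ^ 2 + N * P / q) = W / (2 * P * q) * z + N / 2 * z := by
    field_simp
  have e4 : z ^ 2 * (N + W / (P * q)) = W / (2 * P * q) * (2 * z ^ 2) + N / 2 * (2 * z ^ 2) := by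
    field_simp
    ring
  rw [e3, e4]
  linarith

/-! ### Lower bound for the probability of a close codeword -/

/-- The three terms handle `B ≤ T ≤ A`, `T > A` and `T < B` respectively; the last two are Chernoff
bounds under the tilt `s`. -/
theorem exp_neg_mul_le_tail_add {s t T A B : ℝ} (hs : 0 ≤ s) (ht : 0 ≤ t) :
    Real.exp (-s * T) ≤ (if T ≤ A then Real.exp (-s * B) else 0) +
      Real.exp (-t * A) * Real.exp (-(s - t) * T) + Real.exp (t * B) * Real.exp (-(s + t) * T) := by
  rw [← Real.exp_add, ← Real.exp_add]
  have p1 := Real.exp_pos (-t * A + -(s - t) * T)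
  have p2 := Real.exp_pos (t * B + -(s + t) * T)
  split_ifs with h
  · rcases le_total B T with hB | hB
    · have : Real.exp (-s * T) ≤ Real.exp (-s * B) := Real.exp_le_exp.2 (by nlinarith)
      linarith
    · have : Real.exp (-s * T) ≤ Real.exp (t * B + -(s + t) * T) :=
        Real.exp_le_exp.2 (by nlinarith)
      linarith [Real.exp_pos (-s * B)]
  · have : Real.exp (-s * T) ≤ Real.exp (-t * A + -(s - t) * T) :=
      Real.exp_le_exp.2 (by nlinarith)
    linarith

theorem measurableSet_sum_sq_le {n : ℕ} (x : Fin n → ℝ) (A : ℝ) :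
    MeasurableSet {y : Fin n → ℝ | ∑ i, (x i - y i) ^ 2 ≤ A} :=
  measurableSet_le (by fun_prop) measurable_const

theorem exp_logLaplace_le_fiid_real {n : ℕ} {P s t A B : ℝ} (hP : 0 < P) (ht : 0 ≤ t)
    (hts : t ≤ s) (x : Fin n → ℝ) {F : ℝ → ℝ}
    (hF : F = fun s => -(n / 2) * Real.log (1 + 2 * s * P) -
      s * (∑ i, x i ^ 2) / (1 + 2 * s * P)) :
    Real.exp (F s) ≤ Real.exp (-s * B) * (fiid 0 P).real {y | ∑ i, (x i - y i) ^ 2 ≤ A} +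
      Real.exp (-t * A + F (s - t)) + Real.exp (t * B + F (s + t)) := by
  have hs : 0 ≤ s := ht.trans hts
  have hst : 0 ≤ s - t := sub_nonneg.2 hts
  have hst' : 0 ≤ s + t := add_nonneg hs ht
  have hm := measurableSet_sum_sq_le x A
  have e1 : ∀ y : Fin n → ℝ, (if ∑ i, (x i - y i) ^ 2 ≤ A then Real.exp (-s * B) else 0) =
      {y | ∑ i, (x i - y i) ^ 2 ≤ A}.indicator (fun _ => Real.exp (-s * B)) y := fun y => by
    simp [Set.indicator_apply]
  have i1 : Integrable ({y : Fin n → ℝ | ∑ i, (x i - y i) ^ 2 ≤ A}.indicator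
      fun _ => Real.exp (-s * B)) (fiid 0 P) := (integrable_const _).indicator hm
  have i2 := (integrable_exp_neg_sum_sq_fiid (s - t) P x hst).const_mul (Real.exp (-t * A))
  have i3 := (integrable_exp_neg_sum_sq_fiid (s + t) P x hst').const_mul (Real.exp (t * B))
  have h := integral_mono (integrable_exp_neg_sum_sq_fiid s P x hs) ((i1.add i2).add i3)
    (fun y => by
      have := exp_neg_mul_le_tail_add (T := ∑ i, (x i - y i) ^ 2) (A := A) (B := B) hs ht
      rw [e1] at this
      exact this)
  rw [integral_add' (i1.add i2) i3, integral_add' i1 i2, integral_const_mul, integral_const_mul,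
    integral_indicator_const _ hm, integral_exp_neg_sum_sq_fiid _ _ _ hs hP,
    integral_exp_neg_sum_sq_fiid _ _ _ hst hP, integral_exp_neg_sum_sq_fiid _ _ _ hst' hP] at h
  rw [Real.exp_add, Real.exp_add, mul_comm (Real.exp (-s * B))]
  simpa only [hF, smul_eq_mul] using h

/-- Under the tilt `s` the squared distance has mean `M = W / q² + nP / q`. Deviations by `nδ` gain
`tnδ` in the exponent against a quadratic error, so the window around `M` carries at least half of
the Laplace transform. -/
theorem exists_fiid_real_lower_bound {P s a δ q : ℝ} (hP : 0 < P) (hs : 0 < s) (ha : 0 ≤ a)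
    (hδ : 0 < δ) (hq : q = 1 + 2 * s * P) :
    ∃ c, 0 < c ∧ ∀ (n : ℕ) (x : Fin n → ℝ), 4 * Real.exp (-(n * c)) ≤ 1 →
      ∑ i, x i ^ 2 ≤ n * a →
      1 / 2 * Real.exp (-(n * (1 / 2 * Real.log q + (s / q - s / q ^ 2) * a - s * P / q + s * δ)))
        ≤ (fiid 0 P).real {y | ∑ i, (x i - y i) ^ 2 ≤ n * (a / q ^ 2 + P / q + δ)} := by
  have hq1 : 1 ≤ q := by rw [hq]; nlinarith [mul_pos hs hP]
  have hq0 : 0 < q := by linarith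
  -- The three bounds give: validity of the quadratic estimate, `t ≤ s`, and a quadratic error of at
  -- most half the gain `tnδ`.
  set r := min (1 / 2) (min (2 * P * s / q) (q * δ / (4 * P * (1 + a / (P * q))))) with hr
  have hr0 : 0 < r := by
    refine lt_min (by norm_num) (lt_min ?_ ?_) <;> positivity
  have hr1 : r ≤ 1 / 2 := min_le_left _ _
  have hr2 : r ≤ 2 * P * s / q := (min_le_right _ _).trans (min_le_left _ _)
  have hr3 : r * (1 + a / (P * q)) ≤ q * δ / (4 * P) := by
    have : r ≤ q * δ / (4 * P * (1 + a / (P * q))) := (min_le_right _ _).trans (min_le_right _ _)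
    calc _ ≤ q * δ / (4 * P * (1 + a / (P * q))) * (1 + a / (P * q)) :=
          mul_le_mul_of_nonneg_right this (by positivity)
      _ = _ := by field_simp
  set t := q * r / (2 * P) with ht
  have ht0 : 0 < t := by positivity
  have hts : t ≤ s := by
    rw [ht, div_le_iff₀ (by positivity)]
    rw [le_div_iff₀ hq0] at hr2
    linarith
  refine ⟨t * δ / 2, by positivity, fun n x hn hx => ?_⟩
  set W := ∑ i, x i ^ 2 with hW
  have hW0 : 0 ≤ W := Finset.sum_nonneg fun i _ => sq_nonneg _
  set A := n * (a / q ^ 2 + P / q + δ) with hA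
  set M := W / q ^ 2 + n * P / q with hM
  obtain ⟨F, hF⟩ : ∃ F : ℝ → ℝ, F = fun s => -((n : ℝ) / 2) * Real.log (1 + 2 * s * P) -
      s * W / (1 + 2 * s * P) := ⟨_, rfl⟩
  have hMA : M + n * δ ≤ A := by
    have : W / q ^ 2 ≤ n * a / q ^ 2 := by gcongr
    calc M + n * δ ≤ n * a / q ^ 2 + n * P / q + n * δ := by rw [hM]; linarith
      _ = A := by rw [hA]; ring
  have hquad : r ^ 2 * (n + W / (P * q)) ≤ n * (t * δ / 2) := by
    have h1 : W / (P * q) ≤ n * a / (P * q) := by gcongr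
    calc r ^ 2 * (n + W / (P * q)) ≤ r ^ 2 * (n + n * a / (P * q)) := by gcongr
      _ = n * r * (r * (1 + a / (P * q))) := by ring
      _ ≤ n * r * (q * δ / (4 * P)) := by gcongr
      _ = _ := by rw [ht]; field_simp; ring
  have hFs : F s = -((n : ℝ) / 2) * Real.log q - s * W / q := by rw [hF, hq]
  have hup : F (s + t) ≤ F s - t * M + r ^ 2 * (n + W / (P * q)) := by
    have := logLaplace_increment_le (z := r) (Nat.cast_nonneg n) hW0 hP hs.le
      (by rwa [abs_of_pos hr0]) hq
    rw [hFs, hF]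
    exact this
  have hlow : F (s - t) ≤ F s + t * M + r ^ 2 * (n + W / (P * q)) := by
    have := logLaplace_increment_le (z := -r) (Nat.cast_nonneg n) hW0 hP hs.le
      (by rwa [abs_neg, abs_of_pos hr0]) hq
    rw [show s + q * -r / (2 * P) = s - t by rw [ht]; ring,
      show q * -r / (2 * P) = -t by rw [ht]; ring, neg_sq] at this
    rw [hFs, hF]
    linarith
  have hmain := exp_logLaplace_le_fiid_real (A := A) (B := M - n * δ) hP ht0.le hts x hF
  have h1 : Real.exp (-t * A + F (s - t)) ≤ Real.exp (F s) * Real.exp (-(n * (t * δ / 2))) := by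
    rw [← Real.exp_add, Real.exp_le_exp]
    have := mul_le_mul_of_nonneg_left hMA ht0.le
    linarith
  have h2 : Real.exp (t * (M - n * δ) + F (s + t)) ≤
      Real.exp (F s) * Real.exp (-(n * (t * δ / 2))) := by
    rw [← Real.exp_add, Real.exp_le_exp]
    linarith
  set p := (fiid 0 P).real {y | ∑ i, (x i - y i) ^ 2 ≤ A} with hp
  -- Each tail is at most a quarter of `exp (F s)`.
  have h3 : 1 / 2 * Real.exp (F s) ≤ Real.exp (-s * (M - n * δ)) * p := by
    have h4 := mul_le_mul_of_nonneg_left hn (Real.exp_pos (F s)).le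
    linarith
  have h4 : 1 / 2 * Real.exp (s * (M - n * δ) + F s) ≤ p := by
    rw [Real.exp_add]
    have h5 : Real.exp (s * (M - n * δ)) * Real.exp (-s * (M - n * δ)) = 1 := by
      rw [← Real.exp_add]; simp
    calc _ = Real.exp (s * (M - n * δ)) * (1 / 2 * Real.exp (F s)) := by ring
      _ ≤ Real.exp (s * (M - n * δ)) * (Real.exp (-s * (M - n * δ)) * p) := by gcongr
      _ = p := by rw [← mul_assoc, h5, one_mul]
  refine le_trans ?_ h4
  gcongr
  -- The exponent decreases in `W`, so the worst case is `W = na`; hence uniformity in `x`.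
  have hcoef : 0 ≤ s / q - s / q ^ 2 := by
    rw [sub_nonneg]
    exact div_le_div_of_nonneg_left hs.le hq0 (by nlinarith)
  have h6 := mul_le_mul_of_nonneg_left hx hcoef
  rw [hFs, hM]
  have e1 : s * (W / q ^ 2 + n * P / q - n * δ) + (-((n : ℝ) / 2) * Real.log q - s * W / q) =
    -((s / q - s / q ^ 2) * W) - n * (1 / 2 * Real.log q - s * P / q + s * δ) := by ring
  rw [e1]
  linarith


theorem eventually_mul_exp_neg_le (K b : ℝ) {c : ℝ} (hc : 0 < c) (hb : 0 < b) :
    ∀ᶠ n : ℕ in atTop, K * Real.exp (-(n * c)) ≤ b := by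
  have h1 : Tendsto (fun n : ℕ => (n : ℝ) * c) atTop atTop :=
    tendsto_natCast_atTop_atTop.atTop_mul_const hc
  have h2 := (Real.tendsto_exp_neg_atTop_nhds_zero.comp h1).const_mul K
  rw [mul_zero] at h2
  exact h2.eventually_le_const hb

/-- This is the stationarity of `RiidAt` in `s`: the optimal tilt puts the mean distortion exactly
at `D`. -/
theorem one_add_two_mul_sStar_root {a P D : ℝ} (ha : 0 ≤ a) (hD : 0 < D)
    (hs : 0 < sStar a P D) :
    a / (1 + 2 * sStar a P D) ^ 2 + P / (1 + 2 * sStar a P D) = D := by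
  have hq : 0 < 1 + 2 * sStar a P D := by linarith
  have h1 : sStar a P D = (P - 2 * D + Real.sqrt (P ^ 2 + 4 * a * D)) / (4 * D) := by
    unfold sStar at hs ⊢
    exact max_eq_right (le_of_lt ((lt_max_iff.1 hs).resolve_left (lt_irrefl _)))
  have h2 : Real.sqrt (P ^ 2 + 4 * a * D) = 2 * D * (1 + 2 * sStar a P D) - P := by
    rw [h1]
    field_simp
    ring
  have h3 : (2 * D * (1 + 2 * sStar a P D) - P) ^ 2 = P ^ 2 + 4 * a * D := by
    rw [← h2, Real.sq_sqrt (by positivity)]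
  field_simp
  have : 4 * D * (a + P * (1 + 2 * sStar a P D) - D * (1 + 2 * sStar a P D) ^ 2) = 0 := by
    linarith
  have := (mul_eq_zero.1 this).resolve_left (by positivity)
  linarith

theorem eventually_exp_neg_Riid_le_fiid_real {a P D ε : ℝ} (ha : 0 ≤ a) (hP : 0 < P)
    (hD : 0 < D) (hs : 0 < sStar a P D) (hε : 0 < ε) :
    ∀ᶠ n : ℕ in atTop, ∀ x : Fin n → ℝ, ∑ i, x i ^ 2 ≤ n * a →
      Real.exp (-(n * (Riid a P D + ε))) ≤
        (fiid 0 P).real {y | ∑ i, (x i - y i) ^ 2 ≤ n * D} := by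
  have hroot := one_add_two_mul_sStar_root ha hD hs
  rw [Riid]
  set u := sStar a P D with hu
  have hqu : 0 < 1 + 2 * u := by linarith
  -- `g v` is the exponent of the previous bound at tilt `v / P`, with `δ` the gap from the tilted
  -- mean to `D`. At `v = u` the gap vanishes; a slightly larger `v` opens it, at small cost by
  -- continuity.
  obtain ⟨g, hg⟩ : ∃ g : ℝ → ℝ, g = fun v => 1 / 2 * Real.log (1 + 2 * v) +
      (v / P / (1 + 2 * v) - v / P / (1 + 2 * v) ^ 2) * a - v / P * P / (1 + 2 * v) +
      v / P * (D - (a / (1 + 2 * v) ^ 2 + P / (1 + 2 * v))) := ⟨_, rfl⟩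
  have hgu : g u = RiidAt u a P D := by
    have e : g u = 1 / 2 * Real.log (1 + 2 * u) + u * a / ((1 + 2 * u) * P) + u / P * D -
        2 * (u / P * (a / (1 + 2 * u) ^ 2 + P / (1 + 2 * u))) := by
      rw [hg]
      field_simp
      ring
    rw [e, hroot, RiidAt]
    ring
  have hcont : ContinuousAt g u := by
    rw [hg]
    have h0 : 1 + 2 * u ≠ 0 := hqu.ne'
    have hl : ContinuousAt (fun v : ℝ => Real.log (1 + 2 * v)) u :=
      ContinuousAt.log (by fun_prop) h0
    have h2 : (1 + 2 * u) ^ 2 ≠ 0 := pow_ne_zero _ h0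
    fun_prop (disch := assumption)
  have hlt : ∀ᶠ v in nhdsWithin u (Set.Ioi u), g v < RiidAt u a P D + ε / 2 :=
    (hcont.eventually_lt_const (by rw [hgu]; linarith)).filter_mono nhdsWithin_le_nhds
  obtain ⟨v, hv, huv⟩ := (hlt.and self_mem_nhdsWithin).exists
  have huv : u < v := huv
  have hv0 : 0 < v := hs.trans huv
  have hδ : 0 < D - (a / (1 + 2 * v) ^ 2 + P / (1 + 2 * v)) := by
    have h1 : P / (1 + 2 * v) < P / (1 + 2 * u) := by gcongr
    have h2 : a / (1 + 2 * v) ^ 2 ≤ a / (1 + 2 * u) ^ 2 := by gcongr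
    linarith
  obtain ⟨c, hc, hbound⟩ := exists_fiid_real_lower_bound hP (div_pos hv0 hP) ha hδ
    (q := 1 + 2 * v) (by field_simp)
  filter_upwards [eventually_mul_exp_neg_le 4 1 hc one_pos,
    eventually_mul_exp_neg_le 1 (1 / 2) (half_pos hε) (by norm_num)] with n h4 h2 x hx
  refine le_trans ?_ ((hbound n x h4 hx).trans_eq ?_)
  · have e1 : -((n : ℝ) * (RiidAt u a P D + ε)) =
        -(n * (ε / 2)) + -(n * (RiidAt u a P D + ε / 2)) := by ring
    rw [e1, Real.exp_add]
    rw [one_mul] at h2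
    refine mul_le_mul h2 (Real.exp_le_exp.2 (neg_le_neg ?_)) (Real.exp_pos _).le (by norm_num)
    refine mul_le_mul_of_nonneg_left ?_ (Nat.cast_nonneg n)
    rw [hg] at hv
    exact hv.le
  · rw [add_sub_cancel]

/-! ### Codebook sizes with superexponentially small miss probability -/

theorem exists_codebook_size {a P D R : ℝ} (ha : 0 ≤ a) (hP : 0 < P) (hD : 0 < D)
    (hs : 0 < sStar a P D) (hR : Riid a P D ≤ R) (hR0 : 0 ≤ R) :
    ∃ M : ℕ → ℕ+, (∀ ε, 0 < ε → ∀ᶠ n : ℕ in atTop, ((M n : ℕ) : ℝ) ≤ Real.exp (n * (R + ε))) ∧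
      ∀ᶠ n : ℕ in atTop, ∀ x : Fin n → ℝ, ∑ i, x i ^ 2 ≤ n * a →
        fiid 0 P {y | n * D < ∑ i, (x i - y i) ^ 2} ^ (M n : ℕ) ≤
          ENNReal.ofReal (Real.exp (-(n : ℝ) ^ 2)) := by
  set p : ℕ → ℝ := fun n => ⨅ x : {x : Fin n → ℝ // ∑ i, x i ^ 2 ≤ n * a},
    (fiid 0 P).real {y | ∑ i, (x.1 i - y i) ^ 2 ≤ n * D} with hp
  have hle : ∀ (n : ℕ) (x : Fin n → ℝ), ∑ i, x i ^ 2 ≤ n * a →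
      p n ≤ (fiid 0 P).real {y | ∑ i, (x i - y i) ^ 2 ≤ n * D} := fun n x hx =>
    ciInf_le ⟨0, by rintro _ ⟨x, rfl⟩; exact measureReal_nonneg⟩ (⟨x, hx⟩ : {x : Fin n → ℝ //
      ∑ i, x i ^ 2 ≤ n * a})
  have hlow : ∀ ε, 0 < ε → ∀ᶠ n : ℕ in atTop, Real.exp (-(n * (R + ε))) ≤ p n := by
    intro ε hε
    filter_upwards [eventually_exp_neg_Riid_le_fiid_real ha hP hD hs hε] with n hn
    have : Nonempty {x : Fin n → ℝ // ∑ i, x i ^ 2 ≤ n * a} :=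
      ⟨⟨0, by simpa using mul_nonneg (Nat.cast_nonneg n) ha⟩⟩
    refine le_ciInf fun x => le_trans (Real.exp_le_exp.2 (neg_le_neg ?_)) (hn x.1 x.2)
    gcongr
  -- With `M ≥ n² / p`, `(1 - p)^M ≤ e^{-pM} ≤ e^{-n²}`. Taking `p` as the infimum over typical
  -- words makes `M` independent of `x` and `ε`.
  refine ⟨fun n => ⟨⌊(n : ℝ) ^ 2 / p n⌋₊ + 1, Nat.succ_pos _⟩, fun ε hε => ?_, ?_⟩
  · have hgrow : ∀ᶠ n : ℕ in atTop, (n : ℝ) ^ 2 + 1 ≤ Real.exp (n * (ε / 2)) := by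
      have h := (Real.tendsto_pow_mul_exp_neg_atTop_nhds_zero 2).comp
        (tendsto_natCast_atTop_atTop.atTop_mul_const (half_pos hε) :
          Tendsto (fun n : ℕ => (n : ℝ) * (ε / 2)) atTop atTop)
      have h1 := h.eventually_le_const (show (0 : ℝ) < (ε / 2) ^ 2 / 2 by positivity)
      filter_upwards [h1, eventually_mul_exp_neg_le 1 (1 / 2) (half_pos hε) (by norm_num)]
        with n h2 h3
      simp only [Function.comp_apply] at h2
      have e : Real.exp (-(n * (ε / 2))) * Real.exp (n * (ε / 2)) = 1 := by
        rw [← Real.exp_add]; simp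
      have h4 : (n : ℝ) ^ 2 * Real.exp (-(n * (ε / 2))) ≤ 1 / 2 := by
        have : (0 : ℝ) < (ε / 2) ^ 2 := by positivity
        refine le_of_mul_le_mul_left ?_ this
        linarith
      calc (n : ℝ) ^ 2 + 1 = ((n : ℝ) ^ 2 * Real.exp (-(n * (ε / 2))) +
            1 * Real.exp (-(n * (ε / 2)))) * Real.exp (n * (ε / 2)) := by
              rw [← add_mul, mul_assoc, e, mul_one]
        _ ≤ 1 * Real.exp (n * (ε / 2)) :=
              mul_le_mul_of_nonneg_right (by linarith) (Real.exp_pos _).le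
        _ = _ := one_mul _
    filter_upwards [hgrow, hlow (ε / 2) (half_pos hε)] with n h1 h2
    have hpn : 0 < p n := (Real.exp_pos _).trans_le h2
    have h3 : (n : ℝ) ^ 2 / p n ≤ (n : ℝ) ^ 2 * Real.exp (n * (R + ε / 2)) := by
      rw [div_le_iff₀ hpn]
      calc (n : ℝ) ^ 2 = (n : ℝ) ^ 2 * Real.exp (n * (R + ε / 2)) *
            Real.exp (-(n * (R + ε / 2))) := by
              rw [mul_assoc, ← Real.exp_add, add_neg_cancel, Real.exp_zero, mul_one]
        _ ≤ _ := by gcongr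
    have h4 : 1 ≤ Real.exp (n * (R + ε / 2)) := Real.one_le_exp (by positivity)
    calc (((⌊(n : ℝ) ^ 2 / p n⌋₊ + 1 : ℕ)) : ℝ) ≤ (n : ℝ) ^ 2 / p n + 1 := by
          push_cast
          gcongr
          exact Nat.floor_le (by positivity)
      _ ≤ ((n : ℝ) ^ 2 + 1) * Real.exp (n * (R + ε / 2)) := by linarith
      _ ≤ Real.exp (n * (ε / 2)) * Real.exp (n * (R + ε / 2)) := by gcongr
      _ = Real.exp (n * (R + ε)) := by rw [← Real.exp_add]; ring_nf
  · filter_upwards [hlow 1 one_pos] with n h2 x hx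
    have hpn : 0 < p n := (Real.exp_pos _).trans_le h2
    have hcompl : {y : Fin n → ℝ | n * D < ∑ i, (x i - y i) ^ 2} =
        {y | ∑ i, (x i - y i) ^ 2 ≤ n * D}ᶜ := by ext; simp
    rw [← ofReal_measureReal, hcompl, probReal_compl_eq_one_sub (measurableSet_sum_sq_le x _),
      ← ENNReal.ofReal_pow (sub_nonneg.2 measureReal_le_one)]
    refine ENNReal.ofReal_le_ofReal ?_
    have h3 : 1 - (fiid 0 P).real {y | ∑ i, (x i - y i) ^ 2 ≤ n * D} ≤ Real.exp (-p n) :=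
      le_trans (by linarith [hle n x hx]) (Real.one_sub_le_exp_neg (p n))
    refine (pow_le_pow_left₀ (sub_nonneg.2 measureReal_le_one) h3 _).trans ?_
    rw [← Real.exp_nat_mul, Real.exp_le_exp, mul_neg, neg_le_neg_iff]
    have h4 := Nat.lt_floor_add_one ((n : ℝ) ^ 2 / p n)
    rw [div_lt_iff₀ hpn] at h4
    simpa using h4.le


/-! ### Union bound for the excess-distortion event -/

theorem lt_dist2_iff {n : ℕ} (hn : 0 < n) (x y : Fin n → ℝ) (D : ℝ) :
    D < dist2 x y ↔ n * D < ∑ i, (x i - y i) ^ 2 := by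
  have : (0 : ℝ) < n := Nat.cast_pos.2 hn
  rw [dist2, one_div, ← div_eq_inv_mul, lt_div_iff₀ this, mul_comm]

theorem dist2_nearest_le {n : ℕ} {M : ℕ+} (x : Fin n → ℝ) (c : Fin M → Fin n → ℝ) (k : Fin M) :
    dist2 x (c (nearest x c)) ≤ dist2 x (c k) := by
  have h := Finset.min'_mem _ (exists_minimizer x c)
  exact (Finset.mem_filter.1 h).2 k

theorem measurableSet_lt_sum_sq {n : ℕ} (x : Fin n → ℝ) (A : ℝ) :
    MeasurableSet {y : Fin n → ℝ | A < ∑ i, (x i - y i) ^ 2} :=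
  measurableSet_lt measurable_const (by fun_prop)

theorem fiid_lt_sum_sq_eq {n : ℕ} (c x : Fin n → ℝ) (P A : ℝ) :
    fiid c P {z | A < ∑ k, (x k - z k) ^ 2} =
      fiid 0 P {w | A < ∑ k, ((x - c) k - w k) ^ 2} := by
  rw [fiid_eq_map, Measure.map_apply (by fun_prop) (measurableSet_lt_sum_sq x A)]
  congr 1
  ext w
  simp only [Set.mem_preimage, Set.mem_ofPred_eq, Pi.sub_apply]
  congr! 3
  ring

instance (n : ℕ) (M₁ : ℕ+) (P : ℝ) : IsProbabilityMeasure (codebook1Law n M₁ P) := by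
  unfold codebook1Law; infer_instance

theorem codebook1Law_forall_mem (n : ℕ) (M₁ : ℕ+) (P : ℝ) (B : Set (Fin n → ℝ)) :
    codebook1Law n M₁ P {Y | ∀ i, Y i ∈ B} = fiid 0 P B ^ (M₁ : ℕ) := by
  have : {Y : Codebook1 n M₁ | ∀ i, Y i ∈ B} = Set.univ.pi fun _ => B := by ext; simp
  rw [codebook1Law, this, Measure.pi_pi]
  simp

theorem codebook2CondLaw_forall_mem (n : ℕ) (M₁ M₂ : ℕ+) (P : ℝ) (Y : Codebook1 n M₁)
    (i : Fin M₁) {B : Set (Fin n → ℝ)} (hB : MeasurableSet B) :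
    codebook2CondLaw n M₁ M₂ P Y {Z | ∀ j, Z i j ∈ B} = fiid (Y i) P B ^ (M₂ : ℕ) := by
  have e : {Z : Codebook2 n M₁ M₂ | ∀ j, Z i j ∈ B} =
      Function.eval i ⁻¹' (Set.univ.pi fun _ : Fin M₂ => B) := by ext; simp
  rw [codebook2CondLaw, e, (measurePreserving_eval (fun i => Measure.pi fun _ : Fin M₂ =>
    fiid (Y i) P) i).measure_preimage (MeasurableSet.univ_pi fun _ => hB).nullMeasurableSet,
    Measure.pi_pi]
  simp

/-- The excess-distortion event is covered by an atypical source word, a first layer without a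
close codeword, and, for each `i`, a close `Y i` none of whose refinements is close. -/
theorem jep_le {PX : Measure ℝ} [IsProbabilityMeasure PX] {PY PZ D₁ D₂ Δ α : ℝ} {n : ℕ}
    {M₁ M₂ : ℕ+} {η : ENNReal} (hn : 0 < n) (hΔ : Δ ≤ D₁)
    (h₁ : ∀ x : Fin n → ℝ, ∑ i, x i ^ 2 ≤ n * α →
      fiid 0 PY {y | n * Δ < ∑ i, (x i - y i) ^ 2} ^ (M₁ : ℕ) ≤ η)
    (h₂ : ∀ x : Fin n → ℝ, ∑ i, x i ^ 2 ≤ n * Δ →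
      fiid 0 PZ {y | n * D₂ < ∑ i, (x i - y i) ^ 2} ^ (M₂ : ℕ) ≤ η) :
    jep PX PY PZ D₁ D₂ n M₁ M₂ ≤
      (Measure.pi fun _ : Fin n => PX) {x | n * α < ∑ i, x i ^ 2} + (η + (M₁ : ℕ) * η) := by
  set S₀ : Set ((Fin n → ℝ) × (Codebook1 n M₁ × Codebook2 n M₁ M₂)) :=
    {p | n * α < ∑ k, p.1 k ^ 2} with hS₀
  set S₁ : Set ((Fin n → ℝ) × (Codebook1 n M₁ × Codebook2 n M₁ M₂)) :=
    {p | ∑ k, p.1 k ^ 2 ≤ n * α ∧ ∀ i, n * Δ < ∑ k, (p.1 k - p.2.1 i k) ^ 2} with hS₁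
  -- Letting `i` range over all indices, not just the encoder's choice, avoids conditioning on that
  -- choice.
  set S₂ : Fin M₁ → Set ((Fin n → ℝ) × (Codebook1 n M₁ × Codebook2 n M₁ M₂)) := fun i =>
    {p | ∑ k, (p.1 k - p.2.1 i k) ^ 2 ≤ n * Δ ∧
      ∀ j, n * D₂ < ∑ k, (p.1 k - p.2.2 i j k) ^ 2} with hS₂
  have hcover : {p : (Fin n → ℝ) × (Codebook1 n M₁ × Codebook2 n M₁ M₂) |
      D₁ < dist2 p.1 (rep1 p.2.1 p.1) ∨ D₂ < dist2 p.1 (rep2 p.2.1 p.2.2 p.1)} ⊆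
      S₀ ∪ (S₁ ∪ ⋃ i, S₂ i) := by
    rintro ⟨x, Y, Z⟩ hp
    by_contra hnot
    simp only [Set.mem_union, Set.mem_iUnion, not_or, not_exists] at hnot
    obtain ⟨h0, h1, h2⟩ := hnot
    have h0 : ∑ k, x k ^ 2 ≤ n * α := not_lt.1 h0
    have h1 : ∃ i, dist2 x (Y i) ≤ Δ := by
      by_contra hno
      push Not at hno
      exact h1 ⟨h0, fun i => (lt_dist2_iff hn _ _ _).1 (hno i)⟩
    obtain ⟨i, hi⟩ := h1
    have hf : dist2 x (Y (enc1 Y x)) ≤ Δ := (dist2_nearest_le x Y i).trans hi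
    have h3 : ∃ j, dist2 x (Z (enc1 Y x) j) ≤ D₂ := by
      by_contra hno
      push Not at hno
      refine h2 (enc1 Y x) ⟨?_, fun j => (lt_dist2_iff hn _ _ _).1 (hno j)⟩
      exact not_lt.1 fun h => hf.not_gt ((lt_dist2_iff hn _ _ _).2 h)
    obtain ⟨j, hj⟩ := h3
    rcases hp with hp | hp
    · exact hp.not_ge (hf.trans hΔ)
    · exact hp.not_ge ((dist2_nearest_le x (Z (enc1 Y x)) j).trans hj)
  have m₁ : MeasurableSet S₁ := by
    rw [hS₁, Set.ofPred_and, Set.ofPred_forall]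
    exact (measurableSet_le (by fun_prop) measurable_const).inter
      (MeasurableSet.iInter fun i => measurableSet_lt measurable_const (by fun_prop))
  have m₂ : ∀ i, MeasurableSet (S₂ i) := fun i => by
    simp only [hS₂]
    rw [Set.ofPred_and, Set.ofPred_forall]
    exact (measurableSet_le (by fun_prop) measurable_const).inter
      (MeasurableSet.iInter fun j => measurableSet_lt measurable_const (by fun_prop))
  have b₀ : jointLaw PX PY PZ n M₁ M₂ S₀ =
      (Measure.pi fun _ : Fin n => PX) {x | n * α < ∑ i, x i ^ 2} := by
    have : S₀ = {x | n * α < ∑ i, x i ^ 2} ×ˢ Set.univ := by ext; simp [hS₀]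
    rw [this, jointLaw, Measure.prod_prod, measure_univ, mul_one]
  have b₁ : jointLaw PX PY PZ n M₁ M₂ S₁ ≤ η := by
    rw [jointLaw, Measure.prod_apply m₁]
    refine (lintegral_mono fun x => ?_ : _ ≤ ∫⁻ _, η ∂Measure.pi fun _ : Fin n => PX).trans
      (by simp)
    by_cases hx : ∑ k, x k ^ 2 ≤ n * α
    · have e : Prod.mk x ⁻¹' S₁ = Prod.fst ⁻¹'
          {Y : Codebook1 n M₁ | ∀ i, Y i ∈ {y | n * Δ < ∑ k, (x k - y k) ^ 2}} := by
        ext; simp [hS₁, hx]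
      have m : MeasurableSet
          {Y : Codebook1 n M₁ | ∀ i, Y i ∈ {y | n * Δ < ∑ k, (x k - y k) ^ 2}} := by
        rw [Set.ofPred_forall]
        exact MeasurableSet.iInter fun i => measurable_pi_apply i (measurableSet_lt_sum_sq x _)
      rw [e, ← Measure.fst_apply m, Measure.fst_compProd, codebook1Law_forall_mem]
      exact h₁ x hx
    · have e : Prod.mk x ⁻¹' S₁ = ∅ := by ext; simp [hS₁, hx]
      simp [e]
  have b₂ : ∀ i, jointLaw PX PY PZ n M₁ M₂ (S₂ i) ≤ η := by
    intro i
    rw [jointLaw, Measure.prod_apply (m₂ i)]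
    refine (lintegral_mono fun x => ?_ : _ ≤ ∫⁻ _, η ∂Measure.pi fun _ : Fin n => PX).trans
      (by simp)
    rw [Measure.compProd_apply (measurable_prodMk_left (m₂ i))]
    refine (lintegral_mono fun Y => ?_ : _ ≤ ∫⁻ _, η ∂codebook1Law n M₁ PY).trans (by simp)
    by_cases hY : ∑ k, (x k - Y i k) ^ 2 ≤ n * Δ
    · have e : Prod.mk Y ⁻¹' (Prod.mk x ⁻¹' S₂ i) =
          {Z : Codebook2 n M₁ M₂ | ∀ j, Z i j ∈ {z | n * D₂ < ∑ k, (x k - z k) ^ 2}} := by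
        ext; simp [hS₂, hY]
      rw [e]
      change codebook2CondLaw n M₁ M₂ PZ Y _ ≤ η
      rw [codebook2CondLaw_forall_mem _ _ _ _ _ _ (measurableSet_lt_sum_sq x _),
        fiid_lt_sum_sq_eq]
      exact h₂ (x - Y i) hY
    · have e : Prod.mk Y ⁻¹' (Prod.mk x ⁻¹' S₂ i) = ∅ := by ext; simp [hS₂, hY]
      simp [e]
  calc jep PX PY PZ D₁ D₂ n M₁ M₂ ≤ jointLaw PX PY PZ n M₁ M₂ (S₀ ∪ (S₁ ∪ ⋃ i, S₂ i)) :=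
        measure_mono hcover
    _ ≤ jointLaw PX PY PZ n M₁ M₂ S₀ + (jointLaw PX PY PZ n M₁ M₂ S₁ +
          ∑ i, jointLaw PX PY PZ n M₁ M₂ (S₂ i)) := by
        refine (measure_union_le _ _).trans (add_le_add le_rfl ((measure_union_le _ _).trans
          (add_le_add le_rfl (measure_iUnion_fintype_le _ _))))
    _ ≤ _ := by
        rw [b₀]
        gcongr
        refine (Finset.sum_le_sum fun i _ => b₂ i).trans (le_of_eq ?_)
        simp


/-! ### Chernoff bound and passage to exponents -/

theorem pi_lt_sum_sq_le {PX : Measure ℝ} [IsProbabilityMeasure PX] {θ c : ℝ} (hθ : 0 ≤ θ)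
    (hc : cgfSq PX θ = c) (α : ℝ) (n : ℕ) :
    (Measure.pi fun _ : Fin n => PX) {x | n * α < ∑ i, x i ^ 2} ≤
      ENNReal.ofReal (Real.exp (-(n * (θ * α - c)))) := by
  have hI : ∫⁻ x, ENNReal.ofReal (Real.exp (θ * x ^ 2)) ∂PX = ENNReal.ofReal (Real.exp c) := by
    rw [← EReal.exp_coe, ← hc, cgfSq, ENNReal.exp_log]
  have hprod : ∫⁻ x : Fin n → ℝ, ∏ i, ENNReal.ofReal (Real.exp (θ * x i ^ 2))
      ∂(Measure.pi fun _ : Fin n => PX) = ENNReal.ofReal (Real.exp c) ^ n := by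
    rw [lintegral_prod_eq_prod_lintegral_of_indepFun Finset.univ
      (fun i (x : Fin n → ℝ) => ENNReal.ofReal (Real.exp (θ * x i ^ 2)))
      (iIndepFun_pi (X := fun _ x => ENNReal.ofReal (Real.exp (θ * x ^ 2)))
        fun _ => (by fun_prop : Measurable _).aemeasurable) (fun i => by fun_prop)]
    have h1 : ∀ i : Fin n, ∫⁻ x : Fin n → ℝ, ENNReal.ofReal (Real.exp (θ * x i ^ 2))
        ∂(Measure.pi fun _ : Fin n => PX) = ENNReal.ofReal (Real.exp c) := fun i => by
      rw [← hI]
      exact (measurePreserving_eval (fun _ : Fin n => PX) i).lintegral_comp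
        (f := fun x => ENNReal.ofReal (Real.exp (θ * x ^ 2))) (by fun_prop)
    simp [h1]
  have hm : MeasurableSet {x : Fin n → ℝ | n * α < ∑ i, x i ^ 2} :=
    measurableSet_lt measurable_const (by fun_prop)
  calc (Measure.pi fun _ : Fin n => PX) {x | n * α < ∑ i, x i ^ 2}
      = ∫⁻ x, {x : Fin n → ℝ | n * α < ∑ i, x i ^ 2}.indicator 1 x
          ∂(Measure.pi fun _ : Fin n => PX) := (lintegral_indicator_one hm).symm
    _ ≤ ∫⁻ x : Fin n → ℝ, ENNReal.ofReal (Real.exp (-(n * (θ * α)))) *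
          ∏ i, ENNReal.ofReal (Real.exp (θ * x i ^ 2)) ∂(Measure.pi fun _ : Fin n => PX) := by
        refine lintegral_mono fun x => ?_
        rw [← ENNReal.ofReal_prod_of_nonneg fun i _ => (Real.exp_pos _).le,
          ← ENNReal.ofReal_mul (Real.exp_pos _).le, ← Real.exp_sum, ← Real.exp_add,
          ← Finset.mul_sum]
        by_cases hx : x ∈ {x : Fin n → ℝ | n * α < ∑ i, x i ^ 2}
        · rw [Set.indicator_of_mem hx, Pi.one_apply, ← ENNReal.ofReal_one]
          refine ENNReal.ofReal_le_ofReal (Real.one_le_exp ?_)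
          have := mul_le_mul_of_nonneg_left (le_of_lt hx) hθ
          linarith
        · rw [Set.indicator_of_notMem hx]
          exact zero_le
    _ = ENNReal.ofReal (Real.exp (-(n * (θ * α)))) * ENNReal.ofReal (Real.exp c) ^ n := by
        rw [lintegral_const_mul _ (by fun_prop), hprod]
    _ = _ := by
        rw [← ENNReal.ofReal_pow (Real.exp_pos _).le, ← Real.exp_nat_mul,
          ← ENNReal.ofReal_mul (Real.exp_pos _).le, ← Real.exp_add]
        ring_nf

theorem cgfSq_ne_bot (PX : Measure ℝ) [IsProbabilityMeasure PX] (θ : ℝ) : cgfSq PX θ ≠ ⊥ := by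
  rw [cgfSq, Ne, ENNReal.log_eq_bot_iff, lintegral_eq_zero_iff (by fun_prop)]
  intro h
  obtain ⟨x, hx⟩ := h.exists
  have : 0 < ENNReal.ofReal (Real.exp (θ * x ^ 2)) := ENNReal.ofReal_pos.2 (Real.exp_pos _)
  exact this.ne' hx

theorem limsup_log_le_of_eventually_le_exp {m : ℕ → ℝ} {R : ℝ} (hm : ∀ n, 0 < m n)
    (h : ∀ ε, 0 < ε → ∀ᶠ n : ℕ in atTop, m n ≤ Real.exp (n * (R + ε))) :
    limsup (fun n : ℕ => ((1 / (n : ℝ) * Real.log (m n) : ℝ) : EReal)) atTop ≤ (R : EReal) := by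
  refine EReal.le_of_forall_lt_iff_le.1 fun z hz => ?_
  have hz : R < z := EReal.coe_lt_coe_iff.1 hz
  refine limsup_le_of_le (by isBoundedDefault) ?_
  filter_upwards [h (z - R) (sub_pos.2 hz), eventually_gt_atTop 0] with n hn hn0
  rw [EReal.coe_le_coe_iff]
  have hn0 : (0 : ℝ) < n := Nat.cast_pos.2 hn0
  rw [one_div, ← div_eq_inv_mul, div_le_iff₀ hn0]
  have := (Real.log_le_log (hm n) hn).trans_eq (Real.log_exp _)
  linarith

theorem le_liminf_neg_log_of_eventually_le {p : ℕ → ENNReal} {E : ℝ}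
    (h : ∀ b, b < E → ∀ᶠ n : ℕ in atTop, p n ≤ ENNReal.ofReal (Real.exp (-(n * b)))) :
    (E : EReal) ≤ liminf (fun n : ℕ => ((1 / (n : ℝ) : ℝ) : EReal) * (-ENNReal.log (p n)))
      atTop := by
  refine EReal.ge_of_forall_gt_iff_ge.1 fun b hb => ?_
  refine le_liminf_of_le (by isBoundedDefault) ?_
  filter_upwards [h b (EReal.coe_lt_coe_iff.1 hb), eventually_gt_atTop 0] with n hn hn0
  have hn0 : (0 : ℝ) < n := Nat.cast_pos.2 hn0
  have h1 := ENNReal.log_monotone hn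
  rw [ENNReal.log_ofReal_of_pos (Real.exp_pos _), Real.log_exp] at h1
  have h2 : ((n * b : ℝ) : EReal) ≤ -ENNReal.log (p n) := by
    rw [EReal.le_neg, ← EReal.coe_neg]
    exact h1
  calc (b : EReal) = ((1 / (n : ℝ) : ℝ) : EReal) * ((n * b : ℝ) : EReal) := by
        rw [← EReal.coe_mul]
        congr 1
        field_simp
    _ ≤ _ := mul_le_mul_of_nonneg_left h2 (EReal.coe_nonneg.2 (by positivity))

/-- At zero tilt `RiidAt` vanishes. -/
theorem sStar_pos_of_Riid_pos {w P D : ℝ} (h : 0 < Riid w P D) : 0 < sStar w P D := by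
  refine (le_max_left _ _ : 0 ≤ sStar w P D).lt_of_ne fun (h0 : 0 = sStar w P D) => ?_
  rw [Riid, ← h0] at h
  simp [RiidAt] at h

theorem sStar_add_self {P D : ℝ} (hP : 0 < P) (hD : 0 < D) :
    sStar (P + D) P D = P / (2 * D) := by
  have h : Real.sqrt (P ^ 2 + 4 * (P + D) * D) = P + 2 * D := by
    rw [← Real.sqrt_sq (by positivity : 0 ≤ P + 2 * D)]
    ring_nf
  rw [sStar, h, max_eq_right]
  · field_simp
    ring
  · exact div_nonneg (by linarith) (by positivity)

/-- When the source power is `P + D`, the rate is the Gaussian rate-distortion function. -/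
theorem Riid_add_self {P D : ℝ} (hP : 0 < P) (hD : 0 < D) :
    Riid (P + D) P D = 1 / 2 * Real.log ((P + D) / D) := by
  have e : 1 + 2 * (P / (2 * D)) = (P + D) / D := by field_simp; ring
  rw [Riid, sStar_add_self hP hD, RiidAt, e, add_sub_assoc, add_eq_left]
  field_simp
  ring

/-- If first-layer codewords within `Δ` exist at rate `R₁` for all typical source words, and
refining distortion `Δ` to `D₂` is possible at rate `R₂`, then the excess-distortion exponent is
that of atypical source words. -/
theorem achievableExponent_of_typical {PX : Measure ℝ} [IsProbabilityMeasure PX]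
    {PY D₁ D₂ Δ R₁ R₂ α E : ℝ} (hα : 0 ≤ α) (hPY : 0 < PY) (hD₂ : 0 < D₂) (hD₂Δ : D₂ < Δ)
    (hΔ : Δ ≤ D₁) (hR₁ : 0 < R₁) (hR₁α : Riid α PY Δ = R₁) (hR₂ : 0 ≤ R₂)
    (hR₂Δ : 1 / 2 * Real.log (Δ / D₂) ≤ R₂) (hE : 0 ≤ E)
    (htail : ∀ n : ℕ, (Measure.pi fun _ : Fin n => PX) {x | n * α < ∑ i, x i ^ 2} ≤
      ENNReal.ofReal (Real.exp (-(n * E)))) :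
    AchievableExponent PX PY (Δ - D₂) D₁ D₂ R₁ R₂ E := by
  have hΔ0 : 0 < Δ := hD₂.trans hD₂Δ
  have hPZ : 0 < Δ - D₂ := sub_pos.2 hD₂Δ
  have hs₂ : 0 < sStar Δ (Δ - D₂) D₂ := by
    have := sStar_add_self hPZ hD₂
    rw [sub_add_cancel] at this
    rw [this]
    positivity
  have hr₂ : Riid Δ (Δ - D₂) D₂ ≤ R₂ := by
    have := Riid_add_self hPZ hD₂
    rw [sub_add_cancel] at this
    rwa [this]
  obtain ⟨M₁, hM₁, hmiss₁⟩ := exists_codebook_size hα hPY hΔ0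
    (sStar_pos_of_Riid_pos (hR₁α.symm ▸ hR₁)) hR₁α.le hR₁.le
  obtain ⟨M₂, hM₂, hmiss₂⟩ := exists_codebook_size hΔ0.le hPZ hD₂ hs₂ hr₂ hR₂
  refine ⟨hE, M₁, M₂, ?_, ?_, ?_⟩
  · exact limsup_log_le_of_eventually_le_exp (fun n => Nat.cast_pos.2 (M₁ n).pos) hM₁
  · refine limsup_log_le_of_eventually_le_exp (fun n => mul_pos (Nat.cast_pos.2 (M₁ n).pos)
      (Nat.cast_pos.2 (M₂ n).pos)) fun ε hε => ?_
    filter_upwards [hM₁ (ε / 2) (half_pos hε), hM₂ (ε / 2) (half_pos hε)] with n h1 h2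
    refine (mul_le_mul h1 h2 (Nat.cast_nonneg _) (Real.exp_pos _).le).trans_eq ?_
    rw [← Real.exp_add]
    ring_nf
  · refine le_liminf_neg_log_of_eventually_le fun b hb => ?_
    -- For `n ≥ R₁ + 1 + E`, even `M₁ e^{-n²}` is at most `e^{-nE}`; the factor `3` for the three
    -- terms is absorbed by `b < E`.
    filter_upwards [hM₁ 1 one_pos, hmiss₁, hmiss₂, eventually_gt_atTop 0,
      tendsto_natCast_atTop_atTop.eventually_ge_atTop (R₁ + 1 + E),
      eventually_mul_exp_neg_le 3 1 (sub_pos.2 hb) one_pos] with n hsize h1 h2 hn hlarge h3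
    refine (jep_le hn hΔ h1 h2).trans ((add_le_add (htail n) le_rfl).trans ?_)
    rw [← ENNReal.ofReal_natCast, ← ENNReal.ofReal_mul (Nat.cast_nonneg _),
      ← ENNReal.ofReal_add (Real.exp_pos _).le (by positivity),
      ← ENNReal.ofReal_add (Real.exp_pos _).le (by positivity)]
    refine ENNReal.ofReal_le_ofReal ?_
    have hn0 : (0 : ℝ) ≤ n := Nat.cast_nonneg n
    have h4 : Real.exp (-(n : ℝ) ^ 2) ≤ Real.exp (-(n * E)) := by
      rw [Real.exp_le_exp]
      nlinarith
    have h5 : ((M₁ n : ℕ) : ℝ) * Real.exp (-(n : ℝ) ^ 2) ≤ Real.exp (-(n * E)) := by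
      refine (mul_le_mul_of_nonneg_right hsize (Real.exp_pos _).le).trans ?_
      rw [← Real.exp_add, Real.exp_le_exp]
      nlinarith
    calc _ ≤ 3 * Real.exp (-(n * (E - b))) * Real.exp (-(n * b)) := by
          rw [mul_assoc, ← Real.exp_add, ← neg_add, ← mul_add, sub_add_cancel]
          linarith
      _ ≤ 1 * Real.exp (-(n * b)) := by gcongr
      _ = _ := one_mul _

end SuccRef

theorem theorem5 (PX : Measure ℝ) [IsProbabilityMeasure PX] (σ D₁ D₂ R₁ R₂ lam α : ℝ)
    (hint : Integrable (fun x : ℝ => x ^ 2) PX) (hσ : ∫ x, x ^ 2 ∂PX = σ ^ 2)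
    (hD₂ : 0 < D₂) (hD₁ : D₂ < D₁) (hDσ : D₁ < σ ^ 2) (hR₁ : 0 < R₁) (hR₂ : 0 < R₂)
    (hlam : lam = min (D₂ * Real.exp (2 * R₂) / D₁) 1)
    (hα : 0 ≤ α) (hαsol : R₁ = SuccRef.Riid α (σ ^ 2 - lam * D₁) (lam * D₁)) :
    SuccRef.legendreSq PX α ≤
      SuccRef.optExponent PX (σ ^ 2 - lam * D₁) (lam * D₁ - D₂) D₁ D₂ R₁ R₂ := by
  have hD₁0 : 0 < D₁ := hD₂.trans hD₁
  have hΔ : lam * D₁ = min (D₂ * Real.exp (2 * R₂)) D₁ := by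
    rw [hlam, min_mul_of_nonneg _ _ hD₁0.le, one_mul, div_mul_cancel₀ _ hD₁0.ne']
  have hΔD₁ : lam * D₁ ≤ D₁ := hΔ ▸ min_le_right _ _
  have hD₂Δ : D₂ < lam * D₁ := by
    rw [hΔ]
    refine lt_min ?_ hD₁
    exact lt_mul_of_one_lt_right hD₂ (Real.one_lt_exp_iff.2 (by linarith))
  have hR₂Δ : 1 / 2 * Real.log (lam * D₁ / D₂) ≤ R₂ := by
    have h1 : lam * D₁ / D₂ ≤ Real.exp (2 * R₂) := by
      rw [div_le_iff₀ hD₂, mul_comm (Real.exp _), hΔ]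
      exact min_le_left _ _
    have h2 := Real.log_le_log (div_pos (hD₂.trans hD₂Δ) hD₂) h1
    rw [Real.log_exp] at h2
    linarith
  have hach : ∀ E : ℝ, 0 ≤ E →
      (∀ n : ℕ, (Measure.pi fun _ : Fin n => PX) {x | n * α < ∑ i, x i ^ 2} ≤
        ENNReal.ofReal (Real.exp (-(n * E)))) →
      (E : EReal) ≤ SuccRef.optExponent PX (σ ^ 2 - lam * D₁) (lam * D₁ - D₂) D₁ D₂ R₁ R₂ :=
    fun E hE htail => le_iSup₂ (f := fun (E : ℝ) (_ : SuccRef.AchievableExponent PX _ _ _ _ _ _ E)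
      => (E : EReal)) E (SuccRef.achievableExponent_of_typical hα (by linarith) hD₂ hD₂Δ hΔD₁ hR₁
        hαsol.symm hR₂.le hR₂Δ hE htail)
  refine iSup₂_le fun θ hθ => ?_
  -- An infinite cumulant makes the term `⊥`; a nonpositive finite term is dominated by the trivial
  -- exponent `0`.
  induction hc : SuccRef.cgfSq PX θ with
  | bot => exact absurd hc (SuccRef.cgfSq_ne_bot PX θ)
  | top => simp
  | coe c =>
    rw [← EReal.coe_sub]
    rcases le_total 0 (θ * α - c) with h0 | h0
    · exact hach _ h0 fun n => SuccRef.pi_lt_sum_sq_le hθ hc α n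
    · refine (EReal.coe_le_coe_iff.2 h0).trans (hach 0 le_rfl fun n => ?_)
      simpa using prob_le_one
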